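/- Let $(E,d)$ be a complete separable metric space and write $B(z,r)=\{y\in E: d(y,z)<r\}$ for $0<r\le\infty$ (so $B(z,\infty)=E$). Let $\{P_t\}_{t\ge 0}$ be a Markov-Feller semigroup on $E$: a family of Markov transition kernels $P_t(x,dy)$ with $P_0(x,\cdot)=\delta_x$ and $P_{s+t}(x,A)=\int_E P_t(y,A)\,P_s(x,dy)$, such that $P_tf(x)=\int_E f(y)\,P_t(x,dy)$ is continuous in $x$ for every bounded continuous $f$. Let $\{X_t^x\}_{t\ge0}$, $x\in E$, be an associated Feller process, that is, a Markov process with transition semigroup $\{P_t\}$ and $X_0^x=x$ almost surely. Suppose that there is a point $z\in E$ with the following three properties. 1. (Eventual continuity at $z$.) For every bounded Lipschitz function $f:E\to\mathbb R$, $$\limsup_{x\to z}\ \limsup_{t\to\infty}|P_tf(x)-P_tf(z)|=0.$$ 2. There is $\tilde r>0$ such that for all $\varepsilon>0$ and all $r>\tilde r$ there is $T>0$ with $$\inf_{x\in B(z,r)}P_T(x,B(z,\varepsilon))>0.$$ 3. There are $p>0$, $b>0$ and $\kappa\in(0,\infty]$ such that for every $x\in E$ there is a nonincreasing function $\rho_x:(0,\infty)\to(0,\infty)$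 with $\lim_{t\to\infty}\rho_x(t)=0$ and $$\mathbb E\big[d(X_t^x,z)^p\big]\le\rho_x(t)+b\,\mathbf 1_{B(z,\kappa)}(x)\qquad\text{for all }t>0.$$ Then $\{P_t\}_{t\ge0}$ is asymptotically stable: there is a probability measure $\mu$ on $E$ such that, for every probability measure $\nu$ on $E$, the measures $P_t^*\nu=\int_E P_t(x,\cdot)\,\nu(dx)$ converge weakly to $\mu$ as $t\to\infty$. -/

import Mathlib

open MeasureTheory ProbabilityTheory Filter Topology Set
open scoped NNReal ENNReal

/-- A (time-homogeneous) Markov-Feller semigroup on `E`, given by its transition kernels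
`P t x A = P_t(x, A)`: `P_0` is the identity, the Chapman-Kolmogorov equation holds, and every
`P_t` maps bounded continuous functions to (bounded) continuous functions. -/
structure IsMarkovFellerSemigroup {E : Type*} [TopologicalSpace E] [MeasurableSpace E]
    (P : ℝ≥0 → Kernel E E) [∀ t, IsMarkovKernel (P t)] : Prop where
  zero : P 0 = Kernel.id
  add : ∀ s t, P (s + t) = P t ∘ₖ P s
  feller : ∀ t (f : BoundedContinuousFunction E ℝ), Continuous fun x ↦ ∫ y, f y ∂(P t x)

/-- `X x t = X_t^x` is a Markov process with transition semigroup `P`, started from `x`, for every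
`x`: it starts from `x` almost surely and
`Pr(X_{s+t}^x ∈ A | σ(X_u^x : u ≤ s)) = P_t(X_s^x, A)` almost surely.
It is a Feller process when `P` is a Markov-Feller semigroup. -/
structure IsMarkovProcessFor {E Ω : Type*} [MeasurableSpace E] [mΩ : MeasurableSpace Ω]
    (P : ℝ≥0 → Kernel E E) (Pr : Measure Ω) (X : E → ℝ≥0 → Ω → E) : Prop where
  measurable : ∀ x t, Measurable (X x t)
  start : ∀ x, ∀ᵐ ω ∂Pr, X x 0 ω = x
  markov : ∀ x s t (A : Set E), MeasurableSet A →
    Pr[(X x (s + t) ⁻¹' A).indicator (fun _ ↦ (1 : ℝ)) |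
        ⨆ u : Set.Iic s, MeasurableSpace.comap (X x u) inferInstance]
      =ᵐ[Pr] fun ω ↦ (P t (X x s ω)).real A

/-- Eventual continuity at `z`: for every bounded Lipschitz `f`,
`limsup_{x → z} limsup_{t → ∞} |P_t f(x) - P_t f(z)| = 0`. All the functions of which a `limsup`
is taken are bounded (by `2 sup |f|`), so these are genuine upper limits. -/
def EventuallyContinuousAt {E : Type*} [MetricSpace E] [MeasurableSpace E]
    (P : ℝ≥0 → Kernel E E) (z : E) : Prop :=
  ∀ f : E → ℝ, (∃ K, LipschitzWith K f) → (∃ C, ∀ x, |f x| ≤ C) →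
    limsup (fun x ↦ limsup (fun t ↦ |∫ y, f y ∂(P t x) - ∫ y, f y ∂(P t z)|) atTop) (𝓝 z) = 0

/-- The dual semigroup on probability measures: `P_t^* ν (A) = ∫ P_t(x, A) ν(dx)`. -/
noncomputable def dualSemigroup {E : Type*} [MeasurableSpace E] (P : ℝ≥0 → Kernel E E)
    [∀ t, IsMarkovKernel (P t)] (t : ℝ≥0) (ν : ProbabilityMeasure E) : ProbabilityMeasure E :=
  ⟨(ν : Measure E).bind (P t), inferInstance⟩

/-- Asymptotic stability: there is a probability measure `μ` such that `P_t^* ν → μ` weakly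
as `t → ∞`, for every probability measure `ν`. -/
def AsymptoticallyStable {E : Type*} [TopologicalSpace E] [MeasurableSpace E]
    [OpensMeasurableSpace E] (P : ℝ≥0 → Kernel E E) [∀ t, IsMarkovKernel (P t)] : Prop :=
  ∃ μ : ProbabilityMeasure E, ∀ ν : ProbabilityMeasure E,
    Tendsto (fun t ↦ dualSemigroup P t ν) atTop (𝓝 μ)

/-! It is enough that for each bounded Lipschitz `f` the averages `P_t f(x)` converge to a limit not
depending on `x`. Weak sequential completeness then turns the limits along `P_n(z, ·)` into a
measure `μ`, and dominated convergence integrates the statement over `ν`.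

Convergence at `z` (`exists_tendsto_avg_self`) compares two independent copies started at `z` and
observed at different late times. Eventual continuity controls `|P_t f(x) - P_t f(z)|` only after a
time depending on `x`; Baire's theorem on the closed set of points reachable from `z`, which carries
every `P_s(z, ·)`, makes this time uniform on the reachable part of some ball `U`. The moment bound
keeps both copies in a large ball up to mass `e`. From that ball, condition 2 followed by the Feller
property gives a uniform chance that both copies enter `U` together. Pairs that have entered
contribute little, the others decay geometrically, and the leak `e` does not accumulate
(`exists_lintegral_iterate_le`). So `P_t f(z)` is Cauchy.

From any other `x`, a small ball around `z`, on which `P_t f` is eventually near the limit, is hit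
with a probability bounded below; restarting after each failure transfers the limit to `x`
(`eventually_enorm_avg_sub_le`).

Weak sequential completeness rests on a second use of Baire, in the compact space of unit-valued
`K`-Lipschitz functions: convergence of integrals forces tightness, and Prokhorov's theorem applies.
-/

/-! ### Weak sequential completeness of probability measures -/

/-- The `K`-Lipschitz functions with values in the unit interval. -/
def unitLipschitz (E : Type*) [MetricSpace E] (K : ℝ≥0) : Set (E → ℝ) :=
  {f | LipschitzWith K f ∧ ∀ x, f x ∈ Icc (0 : ℝ) 1}

theorem isCompact_unitLipschitz {E : Type*} [MetricSpace E] (K : ℝ≥0) :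
    IsCompact (unitLipschitz E K) := by
  have hc : IsCompact (univ.pi fun _ : E ↦ Icc (0 : ℝ) 1) :=
    isCompact_univ_pi fun _ ↦ isCompact_Icc
  refine hc.of_isClosed_subset ?_ fun f hf x _ ↦ hf.2 x
  have : unitLipschitz E K = (⋂ (x : E) (y : E), {f | dist (f x) (f y) ≤ K * dist x y}) ∩
      univ.pi fun _ : E ↦ Icc (0 : ℝ) 1 := by
    ext f
    simp only [unitLipschitz, lipschitzWith_iff_dist_le_mul, mem_ofPred_eq, mem_inter_iff,
      mem_iInter, mem_univ_pi]
  rw [this]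
  refine IsClosed.inter (isClosed_iInter fun x ↦ isClosed_iInter fun y ↦ ?_)
    (isClosed_set_pi fun _ _ ↦ isClosed_Icc)
  exact isClosed_le (by fun_prop) (by fun_prop)

/-- Values on a countable dense set determine a continuous function, so by compactness the space
embeds in a countable power of the line. First countability makes dominated convergence usable for
continuity of the integral. -/
theorem firstCountableTopology_unitLipschitz {E : Type*} [MetricSpace E]
    [TopologicalSpace.SeparableSpace E] (K : ℝ≥0) :
    FirstCountableTopology (unitLipschitz E K) := by
  have := isCompact_iff_compactSpace.1 (isCompact_unitLipschitz (E := E) K)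
  obtain ⟨s, hs, hd⟩ := TopologicalSpace.exists_countable_dense E
  have : Countable s := hs
  let φ : unitLipschitz E K → (s → ℝ) := fun f i ↦ f.1 i
  have hφ : Continuous φ := continuous_pi fun i ↦
    (continuous_apply (i : E)).comp continuous_subtype_val
  have hinj : Function.Injective φ := by
    intro f g h
    apply Subtype.ext
    refine Continuous.ext_on hd f.2.1.continuous g.2.1.continuous fun x hx ↦ ?_
    exact congrFun h ⟨x, hx⟩
  exact (hφ.isClosedEmbedding hinj).isEmbedding.firstCountableTopology

theorem continuous_integral_unitLipschitz {E : Type*} [MetricSpace E]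
    [SecondCountableTopology E] [MeasurableSpace E] [BorelSpace E] (K : ℝ≥0)
    (μ : Measure E) [IsFiniteMeasure μ] :
    Continuous fun f : unitLipschitz E K ↦ ∫ x, f.1 x ∂μ := by
  have := firstCountableTopology_unitLipschitz (E := E) K
  refine continuous_of_dominated (bound := fun _ ↦ 1) (fun f ↦ ?_) (fun f ↦ ?_)
    (integrable_const _) ?_
  · exact f.2.1.continuous.aestronglyMeasurable
  · refine ae_of_all _ fun x ↦ ?_
    rw [Real.norm_eq_abs, abs_le]
    constructor <;> linarith [(f.2.2 x).1, (f.2.2 x).2]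
  · exact ae_of_all _ fun x ↦ (continuous_apply x).comp continuous_subtype_val

/-- If the integrals of all bounded Lipschitz functions converge along a sequence of probability
measures, then the tail of the sequence is almost concentrated near a compact set. -/
theorem exists_isCompact_tail_le {E : Type*} [MetricSpace E] [CompleteSpace E]
    [SecondCountableTopology E] [MeasurableSpace E] [BorelSpace E]
    {μ : ℕ → Measure E} [∀ n, IsProbabilityMeasure (μ n)]
    (hμ : ∀ f : E → ℝ, (∃ K, LipschitzWith K f) → (∃ C, ∀ x, |f x| ≤ C) →
      ∃ L, Tendsto (fun n ↦ ∫ x, f x ∂(μ n)) atTop (𝓝 L))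
    (K : ℝ≥0) {η : ℝ} (hη : 0 < η) :
    ∃ C : Set E, IsCompact C ∧ C.Nonempty ∧ ∃ N, ∀ n ≥ N,
      (μ n).real {x | 1 ≤ K * Metric.infDist x C} ≤ 3 * η := by
  have := isCompact_iff_compactSpace.1 (isCompact_unitLipschitz (E := E) K)
  have h0 : (fun _ ↦ 0 : E → ℝ) ∈ unitLipschitz E K :=
    ⟨(LipschitzWith.const 0).weaken (zero_le), fun _ ↦ by simp⟩
  have : Nonempty (unitLipschitz E K) := ⟨⟨_, h0⟩⟩
  -- Closed sets of functions whose integrals have settled within `η` from index `N` on. They cover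
  -- the space, so by Baire one of them has an interior point `f₀`.
  let A : ℕ → Set (unitLipschitz E K) := fun N ↦
    {f | ∀ n ≥ N, dist (∫ x, f.1 x ∂(μ n)) (∫ x, f.1 x ∂(μ N)) ≤ η}
  have hAc : ∀ N, IsClosed (A N) := by
    intro N
    have : A N = ⋂ (n) (_ : n ≥ N), {f : unitLipschitz E K |
        dist (∫ x, f.1 x ∂(μ n)) (∫ x, f.1 x ∂(μ N)) ≤ η} := by ext; simp [A]
    rw [this]
    exact isClosed_iInter fun n ↦ isClosed_iInter fun _ ↦
      isClosed_le ((continuous_integral_unitLipschitz K (μ n)).dist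
        (continuous_integral_unitLipschitz K (μ N))) continuous_const
  have hAu : ⋃ N, A N = univ := by
    refine eq_univ_of_forall fun f ↦ mem_iUnion.2 ?_
    obtain ⟨L, hL⟩ := hμ f.1 ⟨K, f.2.1⟩
      ⟨1, fun x ↦ abs_le.2 ⟨by linarith [(f.2.2 x).1], (f.2.2 x).2⟩⟩
    obtain ⟨N, hN⟩ := Metric.cauchySeq_iff'.1 hL.cauchySeq η hη
    exact ⟨N, fun n hn ↦ (hN n hn).le⟩
  obtain ⟨N, f₀, hf₀⟩ := nonempty_interior_of_iUnion_of_closed hAc hAu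
  obtain ⟨V, hV, hVA⟩ := isOpen_induced_iff.1 (isOpen_interior (s := A N))
  have hfV : f₀.1 ∈ V := by
    have : f₀ ∈ Subtype.val ⁻¹' V := hVA ▸ hf₀
    exact this
  -- A pointwise neighbourhood only constrains finitely many points `I`: away from `I` the function
  -- may be changed freely within the class.
  obtain ⟨I, u, hu, hIu⟩ := isOpen_pi_iff.1 hV f₀.1 hfV
  have key : ∀ g : unitLipschitz E K, (∀ x ∈ I, g.1 x = f₀.1 x) → g ∈ A N := by
    intro g hg
    apply interior_subset (s := A N)
    rw [← hVA]
    exact hIu fun x hx ↦ by rw [hg x hx]; exact (hu x hx).2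
  obtain ⟨C₁, hC₁, hC₁μ⟩ := isTightMeasureSet_iff_exists_isCompact_measure_compl_le.1
    (isTightMeasureSet_singleton (μ := μ N)) (ENNReal.ofReal η) (ENNReal.ofReal_pos.2 hη)
  -- The point `x₀` keeps `C` nonempty, since `infDist` to the empty set is `0`.
  obtain ⟨x₀⟩ : Nonempty E := (μ 0).nonempty_of_neZero
  have hC : IsCompact (insert x₀ (C₁ ∪ I)) := (hC₁.union I.finite_toSet.isCompact).insert x₀
  refine ⟨insert x₀ (C₁ ∪ I), hC, insert_nonempty _ _, N, fun n hn ↦ ?_⟩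
  set C := insert x₀ (C₁ ∪ (I : Set E)) with hCdef
  let h : E → ℝ := fun x ↦ min 1 (K * Metric.infDist x C)
  have hh0 : ∀ x, 0 ≤ h x := fun x ↦ by
    have := Metric.infDist_nonneg (x := x) (s := C)
    simp only [h]; positivity
  have hh1 : ∀ x, h x ≤ 1 := fun x ↦ min_le_left _ _
  have hhC : ∀ x ∈ C, h x = 0 := fun x hx ↦ by simp [h, Metric.infDist_zero_of_mem hx]
  have hhL : LipschitzWith K h := by
    have h1 : LipschitzWith K fun x ↦ (K : ℝ) * Metric.infDist x C := by
      refine LipschitzWith.of_dist_le_mul fun x y ↦ ?_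
      rw [Real.dist_eq, ← mul_sub, abs_mul, NNReal.abs_eq, ← Real.dist_eq]
      gcongr
      simpa using (Metric.lipschitz_infDist_pt C).dist_le_mul x y
    exact h1.const_min 1
  have hf₀L := f₀.2.1
  have hf0 : ∀ x, 0 ≤ f₀.1 x := fun x ↦ (f₀.2.2 x).1
  have hf1 : ∀ x, f₀.1 x ≤ 1 := fun x ↦ (f₀.2.2 x).2
  have hhL' : LipschitzWith K fun x ↦ 1 - h x := by
    refine LipschitzWith.of_dist_le_mul fun x y ↦ ?_
    rw [dist_sub_left]; exact hhL.dist_le_mul x y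
  -- Push `f₀` up to `a` and down to `b` away from `C`. Both agree with `f₀` on `C`, hence on `I`,
  -- and `a - b = 1` where `h = 1`. The gap integrates to at most `η` against `μ N`, and passing to
  -- `μ n` costs `η` for each function: hence `3 * η`.
  let a : unitLipschitz E K := ⟨fun x ↦ max (f₀.1 x) (h x),
    by simpa using hf₀L.max hhL, fun x ↦ ⟨le_max_of_le_left (hf0 x), max_le (hf1 x) (hh1 x)⟩⟩
  let b : unitLipschitz E K := ⟨fun x ↦ min (f₀.1 x) (1 - h x),
    by simpa using hf₀L.min hhL',
    fun x ↦ ⟨le_min (hf0 x) (by linarith [hh1 x]), min_le_of_left_le (hf1 x)⟩⟩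
  have haC : ∀ x ∈ C, a.1 x = f₀.1 x := fun x hx ↦ by simp [a, hhC x hx, hf0 x]
  have hbC : ∀ x ∈ C, b.1 x = f₀.1 x := fun x hx ↦ by simp [b, hhC x hx, hf1 x]
  have hIC : ∀ x ∈ I, x ∈ C := fun x hx ↦ by simp [hCdef, hx]
  have ha := key a (fun x hx ↦ haC x (hIC x hx)) n hn
  have hb := key b (fun x hx ↦ hbC x (hIC x hx)) n hn
  rw [Real.dist_eq, abs_le] at ha hb
  have hint : ∀ (g : unitLipschitz E K) m, Integrable g.1 (μ m) := fun g m ↦ by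
    refine Integrable.of_bound g.2.1.continuous.aestronglyMeasurable 1 (ae_of_all _ fun x ↦ ?_)
    rw [Real.norm_eq_abs, abs_le]
    constructor <;> linarith [(g.2.2 x).1, (g.2.2 x).2]
  have hba : ∀ x, b.1 x ≤ a.1 x := fun x ↦ (min_le_left _ _).trans (le_max_left _ _)
  have e1 : ∫ x, (a.1 x - b.1 x) ∂(μ N) ≤ η := by
    have hC₁m : MeasurableSet C₁ᶜ := hC₁.isClosed.measurableSet.compl
    calc ∫ x, (a.1 x - b.1 x) ∂(μ N) ≤ ∫ x, C₁ᶜ.indicator 1 x ∂(μ N) := by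
          refine integral_mono ((hint a N).sub (hint b N))
            ((integrable_const (1 : ℝ)).indicator hC₁m) fun x ↦ ?_
          by_cases hx : x ∈ C₁
          · have hxC : x ∈ C := by simp [hCdef, hx]
            simp [hx, haC x hxC, hbC x hxC]
          · simp only [mem_compl_iff, hx, not_false_eq_true, indicator_of_mem, Pi.one_apply]
            linarith [(a.2.2 x).2, (b.2.2 x).1]
      _ = (μ N).real C₁ᶜ := integral_indicator_one hC₁m
      _ ≤ η := ENNReal.toReal_le_of_le_ofReal hη.le (hC₁μ _ rfl)
  have hSm : MeasurableSet {x | 1 ≤ K * Metric.infDist x C} :=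
    (isClosed_le continuous_const
      (continuous_const.mul (Metric.continuous_infDist_pt C))).measurableSet
  have e2 : (μ n).real {x | 1 ≤ K * Metric.infDist x C} ≤ ∫ x, (a.1 x - b.1 x) ∂(μ n) := by
    rw [← integral_indicator_one hSm]
    refine integral_mono ((integrable_const (1 : ℝ)).indicator hSm)
      ((hint a n).sub (hint b n)) fun x ↦ ?_
    by_cases hx : 1 ≤ K * Metric.infDist x C
    · have hx1 : h x = 1 := by simp [h, hx]
      simp [a, b, hx, hx1, hf0 x, hf1 x]
    · simp [hx, hba x]
  rw [integral_sub (hint a _) (hint b _)] at e1 e2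
  linarith [ha.1, ha.2, hb.1, hb.2]

/-- Each of the finitely many measures before the tail is tight by itself, so its compact set can be
added to that of the tail. -/
theorem exists_isCompact_forall_le {E : Type*} [MetricSpace E] [CompleteSpace E]
    [SecondCountableTopology E] [MeasurableSpace E] [BorelSpace E]
    {μ : ℕ → Measure E} [∀ n, IsProbabilityMeasure (μ n)]
    (hμ : ∀ f : E → ℝ, (∃ K, LipschitzWith K f) → (∃ C, ∀ x, |f x| ≤ C) →
      ∃ L, Tendsto (fun n ↦ ∫ x, f x ∂(μ n)) atTop (𝓝 L))
    (K : ℝ≥0) {η : ℝ≥0∞} (hη : 0 < η) :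
    ∃ C : Set E, IsCompact C ∧ C.Nonempty ∧ ∀ n, μ n {x | 1 ≤ K * Metric.infDist x C} ≤ η := by
  obtain ⟨η', hη', hle⟩ : ∃ η' : ℝ, 0 < η' ∧ ENNReal.ofReal (3 * η') ≤ η := by
    obtain ⟨q, hq0, hq⟩ := ENNReal.lt_iff_exists_nnreal_btwn.1 hη
    refine ⟨q / 3, by simpa using hq0, ?_⟩
    rw [mul_div_cancel₀ _ (by norm_num), ENNReal.ofReal_coe_nnreal]
    exact hq.le
  obtain ⟨C₀, hC₀, hne, N, hN⟩ := exists_isCompact_tail_le hμ K hη'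
  have : ∀ n, ∃ D : Set E, IsCompact D ∧ μ n Dᶜ ≤ η := fun n ↦ by
    obtain ⟨D, hD, h⟩ := isTightMeasureSet_iff_exists_isCompact_measure_compl_le.1
      (isTightMeasureSet_singleton (μ := μ n)) η hη
    exact ⟨D, hD, h _ rfl⟩
  choose D hD hDμ using this
  refine ⟨C₀ ∪ ⋃ n ∈ Finset.range N, D n,
    hC₀.union ((Finset.range N).isCompact_biUnion fun n _ ↦ hD n), hne.inl, fun n ↦ ?_⟩
  rcases le_or_gt N n with hn | hn
  · refine (measure_mono fun x hx ↦ ?_).trans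
      ((ENNReal.le_ofReal_iff_toReal_le (measure_ne_top _ _) (by positivity)).2 (hN n hn)
        |>.trans hle)
    refine le_trans (α := ℝ) hx ?_
    gcongr
    exact Metric.infDist_le_infDist_of_subset subset_union_left hne
  · refine (measure_mono fun x hx hxD ↦ ?_).trans (hDμ n)
    have : x ∈ C₀ ∪ ⋃ n ∈ Finset.range N, D n := by
      right; simp only [mem_iUnion, Finset.mem_range]; exact ⟨n, hn, hxD⟩
    rw [mem_ofPred_eq, Metric.infDist_zero_of_mem this] at hx
    norm_num at hx

theorem isTightMeasureSet_range_of_tendsto_integral_lipschitz {E : Type*} [MetricSpace E]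
    [CompleteSpace E] [SecondCountableTopology E] [MeasurableSpace E] [BorelSpace E]
    {μ : ℕ → Measure E} [∀ n, IsProbabilityMeasure (μ n)]
    (hμ : ∀ f : E → ℝ, (∃ K, LipschitzWith K f) → (∃ C, ∀ x, |f x| ≤ C) →
      ∃ L, Tendsto (fun n ↦ ∫ x, f x ∂(μ n)) atTop (𝓝 L)) :
    IsTightMeasureSet (range μ) := by
  rw [isTightMeasureSet_iff_exists_isCompact_measure_compl_le]
  intro ε hε
  obtain ⟨η, hη, hsum⟩ := ENNReal.exists_pos_sum_of_countable' hε.ne' ℕ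
  -- The candidate compact set is the intersection over `k` of the closed `1/(k+1)`-neighbourhoods
  -- of `C k`; it is totally bounded because each `C k` is.
  choose C hC hne hCμ using fun k : ℕ ↦
    exists_isCompact_forall_le hμ ((k : ℝ≥0) + 1) (hη k)
  have hK : IsClosed (⋂ k : ℕ, {x | ((k : ℝ) + 1) * Metric.infDist x (C k) ≤ 1}) :=
    isClosed_iInter fun k ↦ isClosed_le
      (continuous_const.mul (Metric.continuous_infDist_pt (C k))) continuous_const
  refine ⟨_, (Metric.totallyBounded_iff.2 ?_).isCompact_of_isClosed hK, ?_⟩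
  · intro δ hδ
    obtain ⟨k, hk⟩ := exists_nat_one_div_lt (half_pos hδ)
    obtain ⟨t, ht, htC⟩ := Metric.totallyBounded_iff.1 (hC k).totallyBounded (δ / 2) (half_pos hδ)
    refine ⟨t, ht, fun x hx ↦ ?_⟩
    have hx := mem_iInter.1 hx k
    have hlt : Metric.infDist x (C k) < δ / 2 := by
      refine lt_of_le_of_lt ?_ hk
      rw [le_div_iff₀ (by positivity), mul_comm]
      exact hx
    obtain ⟨y, hy, hxy⟩ := (Metric.infDist_lt_iff (hne k)).1 hlt
    obtain ⟨c, hc, hyc⟩ := mem_iUnion₂.1 (htC hy)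
    refine mem_iUnion₂.2 ⟨c, hc, ?_⟩
    rw [Metric.mem_ball] at hyc ⊢
    linarith [dist_triangle x y c]
  · rintro _ ⟨n, rfl⟩
    calc μ n (⋂ k : ℕ, {x | ((k : ℝ) + 1) * Metric.infDist x (C k) ≤ 1})ᶜ
        ≤ μ n (⋃ k : ℕ, {x | 1 ≤ (((k : ℝ≥0) + 1 : ℝ≥0) : ℝ) * Metric.infDist x (C k)}) := by
          refine measure_mono fun x hx ↦ ?_
          simp only [mem_compl_iff, mem_iInter, mem_ofPred_eq, not_forall, not_le] at hx
          obtain ⟨k, hk⟩ := hx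
          exact mem_iUnion.2 ⟨k, by simpa using hk.le⟩
      _ ≤ ∑' k : ℕ, μ n {x | 1 ≤ (((k : ℝ≥0) + 1 : ℝ≥0) : ℝ) * Metric.infDist x (C k)} :=
          measure_iUnion_le _
      _ ≤ ∑' k, η k := ENNReal.tsum_le_tsum fun k ↦ hCμ k n
      _ ≤ ε := hsum.le

/-- Weak sequential completeness of the probability measures on a Polish space, with bounded
Lipschitz test functions. -/
theorem exists_tendsto_integral_lipschitz {E : Type*} [MetricSpace E]
    [CompleteSpace E] [SecondCountableTopology E] [MeasurableSpace E] [BorelSpace E]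
    (μ : ℕ → ProbabilityMeasure E)
    (hμ : ∀ f : E → ℝ, (∃ K, LipschitzWith K f) → (∃ C, ∀ x, |f x| ≤ C) →
      ∃ L, Tendsto (fun n ↦ ∫ x, f x ∂(μ n : Measure E)) atTop (𝓝 L)) :
    ∃ ν : ProbabilityMeasure E, ∀ f : E → ℝ, (∃ K, LipschitzWith K f) → (∃ C, ∀ x, |f x| ≤ C) →
      Tendsto (fun n ↦ ∫ x, f x ∂(μ n : Measure E)) atTop (𝓝 (∫ x, f x ∂(ν : Measure E))) := by
  have ht := isTightMeasureSet_range_of_tendsto_integral_lipschitz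
    (μ := fun n ↦ (μ n : Measure E)) hμ
  have hc : IsCompact (closure (range μ)) := by
    refine isCompact_closure_of_isTightMeasureSet (ht.subset ?_)
    rintro _ ⟨_, ⟨n, rfl⟩, rfl⟩
    exact ⟨n, rfl⟩
  -- An ultrafilter limit is enough to identify `ν`, because the integrals are already known to
  -- converge.
  obtain ⟨ν, -, hν⟩ := isCompact_iff_ultrafilter_le_nhds'.1 hc
    ((hyperfilter ℕ).map μ) (mem_map.2 (univ_mem' fun n ↦ subset_closure ⟨n, rfl⟩))
  refine ⟨ν, fun f hf hfb ↦ ?_⟩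
  obtain ⟨L, hL⟩ := hμ f hf hfb
  obtain ⟨C, hC⟩ := hfb
  let g : BoundedContinuousFunction E ℝ :=
    BoundedContinuousFunction.ofNormedAddCommGroup f hf.choose_spec.continuous C hC
  have h1 := (ProbabilityMeasure.tendsto_iff_forall_integral_tendsto.1
    (show Tendsto μ (hyperfilter ℕ : Filter ℕ) (𝓝 ν) from hν)) g
  have h2 := hL.mono_left (Nat.hyperfilter_le_atTop)
  rw [show ∫ x, f x ∂(ν : Measure E) = L from tendsto_nhds_unique h1 h2]
  exact hL

/-! ### Consequences of the moment bound and of eventual continuity -/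

/-- Taking expectations in the Markov property at `s = 0` gives the law of `X x t`, so the moment
hypothesis becomes one on the kernels. -/
theorem IsMarkovProcessFor.map_eq {E Ω : Type*} [MeasurableSpace E]
    [mΩ : MeasurableSpace Ω] {P : ℝ≥0 → Kernel E E} [∀ t, IsMarkovKernel (P t)]
    {Pr : Measure Ω} [IsProbabilityMeasure Pr] {X : E → ℝ≥0 → Ω → E}
    (hX : IsMarkovProcessFor P Pr X) (x : E) (t : ℝ≥0) :
    Pr.map (X x t) = P t x := by
  ext A hA
  rw [Measure.map_apply (hX.measurable x t) hA]
  have hm : (⨆ u : Iic (0 : ℝ≥0), MeasurableSpace.comap (X x u) inferInstance) ≤ mΩ :=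
    iSup_le fun u ↦ (hX.measurable x u).comap_le
  have hS : MeasurableSet (X x t ⁻¹' A) := hX.measurable x t hA
  have h := hX.markov x 0 t A hA
  rw [zero_add] at h
  have h1 := integral_congr_ae h
  rw [integral_condExp hm, integral_indicator hS, setIntegral_const, smul_eq_mul, mul_one] at h1
  have h2 : ∫ ω, (P t (X x 0 ω)).real A ∂Pr = ∫ _ω, (P t x).real A ∂Pr :=
    integral_congr_ae ((hX.start x).mono fun ω hω ↦ by simp only [hω])
  rw [h2, integral_const, probReal_univ, one_smul] at h1
  exact (measureReal_eq_measureReal_iff).1 h1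

theorem measure_compl_ball_le {E : Type*} [MetricSpace E] [MeasurableSpace E] [BorelSpace E]
    (μ : Measure E) (z : E) {p r : ℝ} (hp : 0 < p) (hr : 0 < r) {c : ℝ≥0∞}
    (h : ∫⁻ y, ENNReal.ofReal (dist y z ^ p) ∂μ ≤ c) :
    μ (Metric.ball z r)ᶜ ≤ c / ENNReal.ofReal (r ^ p) := by
  have hrp : 0 < r ^ p := Real.rpow_pos_of_pos hr p
  rw [ENNReal.le_div_iff_mul_le (by simp [hrp]) (by simp), mul_comm]
  refine le_trans ?_ h
  refine le_trans ?_ (mul_meas_ge_le_lintegral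
    (Measurable.ennreal_ofReal (by fun_prop)) (ENNReal.ofReal (r ^ p)))
  gcongr
  intro y hy
  rw [mem_compl_iff, Metric.mem_ball, not_lt] at hy
  exact ENNReal.ofReal_le_ofReal (Real.rpow_le_rpow hr.le hy hp.le)

/-- A uniform asymptotic moment bound makes the mass outside large balls eventually small,
uniformly in the starting point. -/
theorem exists_eventually_measure_compl_ball_le {E : Type*} [MetricSpace E] [MeasurableSpace E]
    [BorelSpace E] {P : ℝ≥0 → Kernel E E} {z : E} {p b : ℝ} (hp : 0 < p) (hb : 0 < b)
    (hmom : ∀ x, ∃ ρ : ℝ≥0 → ℝ, Tendsto ρ atTop (𝓝 0) ∧ ∀ t, 0 < t →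
      ∫⁻ y, ENNReal.ofReal (dist y z ^ p) ∂(P t x) ≤ ENNReal.ofReal (ρ t) + ENNReal.ofReal b)
    (r₀ : ℝ) {η : ℝ≥0∞} (hη : 0 < η) :
    ∃ r, r₀ < r ∧ ∀ x, ∀ᶠ t in atTop, P t x (Metric.ball z r)ᶜ ≤ η := by
  -- Once `ρ t < b` the moment is at most `b + b`, whatever the starting point; only the waiting
  -- time depends on it.
  have hlim : Tendsto (fun r : ℝ ↦ (ENNReal.ofReal b + ENNReal.ofReal b) / ENNReal.ofReal (r ^ p))
      atTop (𝓝 0) := by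
    have h1 : Tendsto (fun r : ℝ ↦ ENNReal.ofReal (r ^ p)) atTop (𝓝 ∞) :=
      ENNReal.tendsto_ofReal_nhds_top.2 (tendsto_rpow_atTop hp)
    simpa using ENNReal.Tendsto.const_div (a := ENNReal.ofReal b + ENNReal.ofReal b) h1
      (Or.inr (by simp))
  obtain ⟨r, hrη, hr0, hr⟩ := ((hlim.eventually_lt_const hη).and
    ((eventually_gt_atTop r₀).and (eventually_gt_atTop 0))).exists
  refine ⟨r, hr0, fun x ↦ ?_⟩
  obtain ⟨ρ, hρ, hx⟩ := hmom x
  filter_upwards [hρ.eventually_lt_const hb, eventually_gt_atTop 0] with t ht ht0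
  refine (measure_compl_ball_le _ z hp hr ((hx t ht0).trans ?_)).trans hrη.le
  gcongr

theorem EventuallyContinuousAt.exists_forall_ball {E : Type*} [MetricSpace E] [MeasurableSpace E]
    {P : ℝ≥0 → Kernel E E} [∀ t, IsMarkovKernel (P t)] {z : E}
    (hz : EventuallyContinuousAt P z) {f : E → ℝ} (hf : ∃ K, LipschitzWith K f) {C : ℝ}
    (hC : ∀ x, |f x| ≤ C) {η : ℝ} (hη : 0 < η) :
    ∃ ε > 0, ∀ x ∈ Metric.ball z ε, ∀ᶠ t in atTop,
      |∫ y, f y ∂(P t x) - ∫ y, f y ∂(P t z)| ≤ η := by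
  have hb : ∀ t x, |∫ y, f y ∂(P t x)| ≤ C := fun t x ↦ by
    simpa using norm_integral_le_of_norm_le_const (μ := P t x) (f := f) (C := C) (ae_of_all _ hC)
  have hd : ∀ t x, |∫ y, f y ∂(P t x) - ∫ y, f y ∂(P t z)| ≤ 2 * C := fun t x ↦
    (abs_sub _ _).trans (by linarith [hb t x, hb t z])
  have hbd : ∀ x, IsBoundedUnder (· ≤ ·) atTop
      fun t ↦ |∫ y, f y ∂(P t x) - ∫ y, f y ∂(P t z)| :=
    fun x ↦ isBoundedUnder_of ⟨2 * C, fun t ↦ hd t x⟩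
  have hlim : ∀ x, limsup (fun t ↦ |∫ y, f y ∂(P t x) - ∫ y, f y ∂(P t z)|) atTop ≤ 2 * C :=
    fun x ↦ limsup_le_of_le (isCoboundedUnder_le_of_le atTop (x := 0) fun t ↦ abs_nonneg _)
      (Eventually.of_forall fun t ↦ hd t x)
  have h := hz f hf ⟨C, hC⟩
  have h1 := eventually_lt_of_limsup_lt (h.trans_lt hη) (isBoundedUnder_of ⟨2 * C, hlim⟩)
  obtain ⟨ε, hε, hball⟩ := Metric.eventually_nhds_iff_ball.1 h1
  exact ⟨ε, hε, fun x hx ↦ (eventually_lt_of_limsup_lt (hball x hx) (hbd x)).mono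
    fun t ht ↦ ht.le⟩

/-! ### The semigroup on functions and the points reachable from `z` -/

/-- The action of the transition kernels on functions: `P_t f (x) = ∫ f(y) P_t(x, dy)`. -/
noncomputable def avg {E : Type*} [MeasurableSpace E] (P : ℝ≥0 → Kernel E E) (f : E → ℝ)
    (t : ℝ≥0) (x : E) : ℝ := ∫ y, f y ∂(P t x)

/-- The closed set of points all of whose neighbourhoods are charged by the process from `z`. -/
def reachable {E : Type*} [MetricSpace E] [MeasurableSpace E] (P : ℝ≥0 → Kernel E E)
    (z : E) : Set E :=
  {y | ∀ U ∈ 𝓝 y, ∃ s, 0 < P s z U}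

theorem isClosed_reachable {E : Type*} [MetricSpace E] [MeasurableSpace E]
    {P : ℝ≥0 → Kernel E E} (z : E) : IsClosed (reachable P z) := by
  rw [← isOpen_compl_iff, isOpen_iff_mem_nhds]
  intro y hy
  simp only [reachable, mem_compl_iff, mem_ofPred_eq, not_forall] at hy
  obtain ⟨U, hU, h⟩ := hy
  filter_upwards [eventually_mem_nhds_iff.2 hU] with x hx hxr
  exact h (hxr U hx)

/-- An unreachable point has a neighbourhood null for all `P s z`, and in a second countable space
locally null sets are null. -/
theorem measure_compl_reachable {E : Type*} [MetricSpace E] [MeasurableSpace E]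
    {P : ℝ≥0 → Kernel E E} [SecondCountableTopology E] (z : E) (s : ℝ≥0) :
    P s z (reachable P z)ᶜ = 0 := by
  refine measure_null_of_locally_null _ fun y hy ↦ ?_
  simp only [reachable, mem_compl_iff, mem_ofPred_eq, not_forall] at hy
  obtain ⟨U, hU, h⟩ := hy
  exact ⟨U, mem_nhdsWithin_of_mem_nhds hU, by simpa using not_exists.1 h s⟩

section Semigroup

variable {E : Type*} [MeasurableSpace E]
  {P : ℝ≥0 → Kernel E E} [∀ t, IsMarkovKernel (P t)] {f : E → ℝ} {C : ℝ}

theorem abs_avg_le (hC : ∀ x, |f x| ≤ C) (t : ℝ≥0) (x : E) : |avg P f t x| ≤ C := by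
  simpa [avg] using norm_integral_le_of_norm_le_const (μ := P t x) (f := f) (C := C)
    (ae_of_all _ hC)

theorem continuous_avg [MetricSpace E] (hP : IsMarkovFellerSemigroup P) (hf : Continuous f)
    (hC : ∀ x, |f x| ≤ C) (t : ℝ≥0) : Continuous (avg P f t) :=
  hP.feller t (BoundedContinuousFunction.ofNormedAddCommGroup f hf C hC)

theorem integrable_of_abs_le {g : E → ℝ} (hg : Measurable g) (hC : ∀ x, |g x| ≤ C)
    (μ : Measure E) [IsFiniteMeasure μ] : Integrable g μ :=
  Integrable.of_bound hg.aestronglyMeasurable C (ae_of_all _ hC)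

theorem avg_add [MetricSpace E] [BorelSpace E] (hP : IsMarkovFellerSemigroup P) (hf : Continuous f)
    (hC : ∀ x, |f x| ≤ C) (s t : ℝ≥0) (x : E) :
    avg P f (s + t) x = ∫ y, avg P f t y ∂(P s x) := by
  simp only [avg, hP.add]
  exact Kernel.integral_comp (integrable_of_abs_le hf.measurable hC _)

/-- By Chapman-Kolmogorov the difference is an integral over two independent copies, run for times
`s` and `s'`. -/
theorem enorm_avg_sub_le [MetricSpace E] [BorelSpace E]
    (hP : IsMarkovFellerSemigroup P) (hf : Continuous f) (hC : ∀ x, |f x| ≤ C)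
    (s s' t : ℝ≥0) (x x' : E) :
    ‖avg P f (s + t) x - avg P f (s' + t) x'‖ₑ ≤
      ∫⁻ u, ‖avg P f t u.1 - avg P f t u.2‖ₑ ∂((P s x).prod (P s' x')) := by
  have hm := (continuous_avg hP hf hC t).measurable
  have hi : ∀ μ : Measure E, IsFiniteMeasure μ → Integrable (avg P f t) μ := fun μ _ ↦
    integrable_of_abs_le hm (abs_avg_le hC t) μ
  have h : avg P f (s + t) x - avg P f (s' + t) x' =
      ∫ u, (avg P f t u.1 - avg P f t u.2) ∂((P s x).prod (P s' x')) := by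
    rw [integral_sub ((hi _ inferInstance).comp_fst _) ((hi _ inferInstance).comp_snd _),
      integral_fun_fst, integral_fun_snd, avg_add hP hf hC, avg_add hP hf hC]
    simp
  rw [h]
  exact enorm_integral_le_lintegral_enorm _

/-- The Feller property is weak continuity of `y ↦ P s y`, so the mass of an open set is lower
semicontinuous by the portmanteau theorem. -/
theorem exists_ball_le_measure [MetricSpace E] [BorelSpace E]
    [SecondCountableTopology E] (hP : IsMarkovFellerSemigroup P)
    {z : E} {U : Set E} (hU : IsOpen U) {s : ℝ≥0} (hs : 0 < P s z U) :
    ∃ ε > 0, ∃ c > 0, ∀ y ∈ Metric.ball z ε, c ≤ P s y U := by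
  obtain ⟨c, hc0, hc⟩ := exists_between hs
  let κ : E → ProbabilityMeasure E := fun y ↦ ⟨P s y, inferInstance⟩
  have hκ : Tendsto κ (𝓝 z) (𝓝 (κ z)) :=
    ProbabilityMeasure.tendsto_iff_forall_integral_tendsto.2 fun g ↦ (hP.feller s g).tendsto z
  have h := ProbabilityMeasure.le_liminf_measure_open_of_tendsto hκ hU
  obtain ⟨ε, hε, hb⟩ := Metric.eventually_nhds_iff_ball.1
    (eventually_lt_of_lt_liminf (hc.trans_le h))
  exact ⟨ε, hε, c, hc0, fun y hy ↦ (hb y hy).le⟩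

theorem mul_le_measure_add [TopologicalSpace E] (hP : IsMarkovFellerSemigroup P)
    {s t : ℝ≥0} {x : E} {A B : Set E}
    (hA : MeasurableSet A) (hB : MeasurableSet B) {c d : ℝ≥0∞} (hc : ∀ y ∈ B, c ≤ P t y A)
    (hd : d ≤ P s x B) : c * d ≤ P (s + t) x A := by
  rw [hP.add, Kernel.comp_apply' _ _ _ hA]
  calc c * d ≤ c * P s x B := by gcongr
    _ = ∫⁻ _ in B, c ∂(P s x) := by simp
    _ ≤ ∫⁻ y in B, P t y A ∂(P s x) := setLIntegral_mono' hB hc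
    _ ≤ ∫⁻ y, P t y A ∂(P s x) := setLIntegral_le_lintegral _ _

/-- Open sets charged by the process started at `z` are reached uniformly from balls around `z`. -/
theorem exists_forall_ball_le_measure [MetricSpace E] [BorelSpace E] [SecondCountableTopology E]
    (hP : IsMarkovFellerSemigroup P) {z : E} {r : ℝ}
    (hirr : ∀ ε : ℝ, 0 < ε → ∃ T : ℝ≥0, 0 < T ∧
      0 < ⨅ x ∈ Metric.ball z r, P T x (Metric.ball z ε))
    {U : Set E} (hU : IsOpen U) {s : ℝ≥0} (hs : 0 < P s z U) :
    ∃ T, ∃ c > 0, ∀ y ∈ Metric.ball z r, c ≤ P T y U := by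
  obtain ⟨ε, hε, c, hc, hb⟩ := exists_ball_le_measure hP hU hs
  obtain ⟨T, -, hT⟩ := hirr ε hε
  exact ⟨T + s, _, ENNReal.mul_pos hc.ne' hT.ne', fun y hy ↦
    mul_le_measure_add hP hU.measurableSet Metric.isOpen_ball.measurableSet hb
      (iInf₂_le y hy)⟩

theorem mem_reachable_self [MetricSpace E] (hP : IsMarkovFellerSemigroup P) (z : E) :
    z ∈ reachable P z := by
  intro U hU
  refine ⟨0, ?_⟩
  rw [hP.zero, Kernel.id_apply, Measure.dirac_apply_of_mem (mem_of_mem_nhds hU)]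
  exact one_pos

/-- By the Baire category theorem, eventual continuity at `z` is uniform in time on a relatively
open set of reachable points. -/
theorem exists_ball_reachable_uniform [MetricSpace E] [CompleteSpace E]
    (hP : IsMarkovFellerSemigroup P) {z : E} (hf : Continuous f) (hC : ∀ x, |f x| ≤ C) {η ε : ℝ}
    (hε : 0 < ε) (h : ∀ x ∈ Metric.ball z ε, ∀ᶠ t in atTop, |avg P f t x - avg P f t z| ≤ η) :
    ∃ w ∈ reachable P z, ∃ δ > 0, ∃ N : ℝ≥0, ∀ x ∈ Metric.ball w δ, x ∈ reachable P z →
      ∀ t ≥ N, |avg P f t x - avg P f t z| ≤ η := by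
  have hcl : IsClosed (reachable P z) := isClosed_reachable z
  have : CompleteSpace (reachable P z) := hcl.completeSpace_coe
  -- Points outside the `ε`-ball are put in every `F n` so that the `F n` cover; the point `w` is
  -- then chosen inside the ball, where only the first alternative remains.
  let F : ℕ → Set (reachable P z) := fun n ↦
    {x | ∀ t : ℝ≥0, n ≤ t → |avg P f t x - avg P f t z| ≤ η} ∪ {x | ε ≤ dist (x : E) z}
  have hFc : ∀ n, IsClosed (F n) := by
    intro n
    refine IsClosed.union ?_ (isClosed_le continuous_const (by fun_prop))
    simp only [ofPred_forall]
    refine isClosed_iInter fun t ↦ isClosed_iInter fun _ ↦ isClosed_le ?_ continuous_const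
    exact (((continuous_avg hP hf hC t).comp continuous_subtype_val).sub continuous_const).abs
  have hFu : ⋃ n, F n = univ := by
    refine eq_univ_of_forall fun x ↦ mem_iUnion.2 ?_
    by_cases hx : (x : E) ∈ Metric.ball z ε
    · obtain ⟨T, hT⟩ := eventually_atTop.1 (h x hx)
      obtain ⟨n, hn⟩ := exists_nat_ge T
      exact ⟨n, Or.inl fun t ht ↦ hT t (hn.trans ht)⟩
    · exact ⟨0, Or.inr (by simpa using hx)⟩
  have hd := dense_iUnion_interior_of_closed hFc hFu
  have hV : IsOpen {x : reachable P z | dist (x : E) z < ε} :=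
    isOpen_lt (by fun_prop) continuous_const
  obtain ⟨w, hwV, hw⟩ := hd.inter_open_nonempty _ hV
    ⟨⟨z, mem_reachable_self hP z⟩, by simpa using hε⟩
  obtain ⟨n, hwn⟩ := mem_iUnion.1 hw
  obtain ⟨δ, hδ, hsub⟩ := Metric.isOpen_iff.1 (isOpen_interior.inter hV) w ⟨hwn, hwV⟩
  refine ⟨w, w.2, δ, hδ, n, fun x hx hxr t ht ↦ ?_⟩
  obtain ⟨h1, h2⟩ := hsub (show (⟨x, hxr⟩ : reachable P z) ∈ Metric.ball w δ from hx)
  rcases interior_subset h1 with h3 | h3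
  · exact h3 t ht
  · exact absurd (show dist x z < ε from h2) (not_lt.2 h3)

end Semigroup

/-! ### Geometric contraction with a bounded leak -/

/-- Iterated contraction: a chain with kernel `Q` hits `A` with probability at least `β = 1 - γ`
from `B`, and the laws in the invariant family `Λ` give mass at most `e` to the complement
of `B`. -/
theorem exists_lintegral_iterate_le {Y : Type*} [MeasurableSpace Y] (Q : Kernel Y Y)
    [IsMarkovKernel Q] {Λ : Set (Measure Y)} (hΛ : ∀ l ∈ Λ, Q ∘ₘ l ∈ Λ)
    {W : ℝ≥0 → Y → ℝ≥0∞} (hWm : ∀ t, Measurable (W t)) {T : ℝ≥0}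
    (hW : ∀ t y, W (T + t) y ≤ ∫⁻ u, W t u ∂(Q y)) {M : ℝ≥0∞} (hM : ∀ t y, W t y ≤ M)
    {A B : Set Y} (hA : MeasurableSet A) (hB : MeasurableSet B) {a : ℝ≥0∞} {N : ℝ≥0}
    (ha : ∀ l ∈ Λ, ∀ t ≥ N, ∀ᵐ y ∂l, y ∈ A → W t y ≤ a) {β γ e : ℝ≥0∞} (hβγ : β + γ = 1)
    (hQ : ∀ y ∈ B, Q y Aᶜ ≤ γ) (he : ∀ l ∈ Λ, l Bᶜ ≤ e) (k : ℕ) :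
    ∃ c, c + γ ^ k = 1 ∧ ∀ l ∈ Λ, ∀ ν ≤ l, ∀ t ≥ N,
      ∫⁻ y, W (k * T + t) y ∂ν ≤ a * ν univ + M * (γ ^ k * ν univ + c * e) := by
  induction k with
  | zero =>
    refine ⟨0, by simp, fun l _ ν _ t _ ↦ ?_⟩
    calc ∫⁻ y, W ((0 : ℕ) * T + t) y ∂ν ≤ ∫⁻ _, M ∂ν := lintegral_mono fun y ↦ hM _ y
      _ = M * ν univ := lintegral_const _
      _ ≤ _ := by simp
  | succ k ih =>
    obtain ⟨c, hc, ih⟩ := ih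
    -- Here `c` is `1 - γ ^ k`, the partial sum of `β * γ ^ j`. As it stays at most `1`, the total
    -- leak is at most `e` for every `k`.
    refine ⟨c + γ ^ k * β, ?_, fun l hl ν hν t ht ↦ ?_⟩
    · rw [pow_succ, add_assoc, ← mul_add, hβγ, mul_one, hc]
    set ν' := Q ∘ₘ ν with hν'
    have hle : ν' ≤ Q ∘ₘ l := Measure.le_iff.2 fun s hs ↦ by
      rw [hν', Measure.bind_apply hs Q.aemeasurable, Measure.bind_apply hs Q.aemeasurable]
      exact lintegral_mono' hν le_rfl
    have huniv : ν' univ = ν univ := by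
      rw [hν', Measure.bind_apply .univ Q.aemeasurable]; simp
    have hcompl : ν' Aᶜ ≤ γ * ν univ + β * e := by
      rw [hν', Measure.bind_apply hA.compl Q.aemeasurable, ← lintegral_add_compl _ hB]
      calc ∫⁻ y in B, Q y Aᶜ ∂ν + ∫⁻ y in Bᶜ, Q y Aᶜ ∂ν
          ≤ ∫⁻ _ in B, γ ∂ν + ∫⁻ _ in Bᶜ, 1 ∂ν :=
            add_le_add (setLIntegral_mono' hB hQ) (lintegral_mono fun y ↦ prob_le_one)
        _ = γ * ν B + (β + γ) * ν Bᶜ := by simp [hβγ]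
        _ = γ * (ν B + ν Bᶜ) + β * ν Bᶜ := by ring
        _ ≤ γ * ν univ + β * e := by
            rw [measure_add_measure_compl hB]
            gcongr
            exact (hν _).trans (he l hl)
    have htN : (k : ℝ≥0) * T + t ≥ N := le_trans ht le_add_self
    have hA1 : ∫⁻ y in A, W (k * T + t) y ∂ν' ≤ a * ν' A := by
      have h1 : ∀ᵐ y ∂ν', y ∈ A → W (k * T + t) y ≤ a :=
        ae_mono hle (ha _ (hΛ l hl) _ htN)
      calc ∫⁻ y in A, W (k * T + t) y ∂ν' ≤ ∫⁻ _ in A, a ∂ν' := setLIntegral_mono_ae' hA h1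
        _ = a * ν' A := by simp
    -- Only the mass outside `A` is iterated further. Its restriction need not lie in `Λ` but is
    -- dominated by a law that does, hence the quantification over `ν ≤ l`.
    have hA2 := ih _ (hΛ l hl) (ν'.restrict Aᶜ) (Measure.restrict_le_self.trans hle) t ht
    rw [Measure.restrict_apply_univ] at hA2
    have hshift : ((k + 1 : ℕ) : ℝ≥0) * T + t = T + (k * T + t) := by push_cast; ring
    calc ∫⁻ y, W ((k + 1 : ℕ) * T + t) y ∂ν
        ≤ ∫⁻ y, ∫⁻ u, W (k * T + t) u ∂(Q y) ∂ν := by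
          rw [hshift]; exact lintegral_mono fun y ↦ hW _ y
      _ = ∫⁻ y, W (k * T + t) y ∂ν' :=
          (Measure.lintegral_bind Q.aemeasurable (hWm _).aemeasurable).symm
      _ = ∫⁻ y in A, W (k * T + t) y ∂ν' + ∫⁻ y in Aᶜ, W (k * T + t) y ∂ν' :=
          (lintegral_add_compl _ hA).symm
      _ ≤ a * ν' A + (a * ν' Aᶜ + M * (γ ^ k * ν' Aᶜ + c * e)) := add_le_add hA1 hA2
      _ = a * (ν' A + ν' Aᶜ) + M * (γ ^ k * ν' Aᶜ + c * e) := by ring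
      _ ≤ a * ν univ + M * (γ ^ k * (γ * ν univ + β * e) + c * e) := by
          rw [measure_add_measure_compl hA, huniv]
          gcongr
      _ = _ := by rw [pow_succ]; ring

theorem prod_compl_prod_le {E : Type*} [MeasurableSpace E]
    {μ ν : Measure E} [IsProbabilityMeasure μ]
    [IsProbabilityMeasure ν] (A : Set E) : (μ.prod ν) (A ×ˢ A)ᶜ ≤ μ Aᶜ + ν Aᶜ := by
  have : (A ×ˢ A)ᶜ ⊆ Aᶜ ×ˢ (univ : Set E) ∪ (univ : Set E) ×ˢ Aᶜ := by
    rintro ⟨x, y⟩ h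
    simp only [mem_compl_iff, mem_prod, mem_union, mem_univ] at h ⊢
    tauto
  refine (measure_mono this).trans ((measure_union_le _ _).trans ?_)
  simp [Measure.prod_prod]

/-! ### Convergence of `P_t f` at `z`, then everywhere -/

section Convergence

variable {E : Type*} [MetricSpace E] [MeasurableSpace E]
  {P : ℝ≥0 → Kernel E E} [∀ t, IsMarkovKernel (P t)] {f : E → ℝ} {C : ℝ} {z : E}

theorem parallelComp_comp_prod_eq (hP : IsMarkovFellerSemigroup P) (T s s' : ℝ≥0) (x x' : E) :
    (P T ∥ₖ P T) ∘ₘ ((P s x).prod (P s' x')) = (P (s + T) x).prod (P (s' + T) x') := by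
  rw [← Kernel.parallelComp_apply (P s) (P s') (x, x'), ← Kernel.comp_apply,
    Kernel.parallelComp_comp_parallelComp, ← hP.add, ← hP.add, Kernel.parallelComp_apply]

/-- Convergence of `P_t f (z)` at the point `z` of eventual continuity. -/
theorem exists_tendsto_avg_self [CompleteSpace E] [SecondCountableTopology E] [BorelSpace E]
    (hP : IsMarkovFellerSemigroup P)
    (hf : Continuous f) (hC : ∀ x, |f x| ≤ C)
    (hec : ∀ η : ℝ, 0 < η → ∃ ε > 0, ∀ x ∈ Metric.ball z ε, ∀ᶠ t in atTop,
      |avg P f t x - avg P f t z| ≤ η)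
    (hball : ∀ η : ℝ≥0∞, 0 < η → ∃ r, 0 < r ∧
      (∀ x, ∀ᶠ t in atTop, P t x (Metric.ball z r)ᶜ ≤ η) ∧
      ∀ ε : ℝ, 0 < ε → ∃ T : ℝ≥0, 0 < T ∧
        0 < ⨅ x ∈ Metric.ball z r, P T x (Metric.ball z ε)) :
    ∃ L, Tendsto (fun t ↦ avg P f t z) atTop (𝓝 L) := by
  refine cauchySeq_tendsto_of_complete (Metric.cauchySeq_iff'.2 fun ε hε ↦ ?_)
  obtain ⟨ε₁, hε₁, hε₁'⟩ := hec (ε / 8) (by positivity)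
  obtain ⟨w, hw, δ, hδ, N, hN⟩ := exists_ball_reachable_uniform hP hf hC hε₁ hε₁'
  set U := Metric.ball w δ with hU
  obtain ⟨s₁, hs₁⟩ := hw U (Metric.ball_mem_nhds w hδ)
  have hC0 : 0 ≤ C := (abs_nonneg _).trans (hC z)
  -- The oscillation of `P_t f` is at most `2 * C`; the extra `1` makes `M` nonzero, so that `e = d
  -- / M` gives `M * e = d`.
  set M : ℝ≥0∞ := ENNReal.ofReal (2 * C + 1) with hMdef
  have hM0 : M ≠ 0 := by simp only [hMdef, ne_eq, ENNReal.ofReal_eq_zero, not_le]; positivity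
  have hMt : M ≠ ∞ := ENNReal.ofReal_ne_top
  set d : ℝ≥0∞ := ENNReal.ofReal (ε / 8) with hd
  have hd0 : 0 < d := ENNReal.ofReal_pos.2 (by positivity)
  set e : ℝ≥0∞ := d / M with he
  have he0 : 0 < e := ENNReal.div_pos hd0.ne' hMt
  obtain ⟨r, hr, hr1, hr2⟩ := hball (e / 2) (ENNReal.half_pos he0.ne')
  obtain ⟨s₀, hs₀⟩ := eventually_atTop.1 (hr1 z)
  obtain ⟨T, c, hc, hT⟩ := exists_forall_ball_le_measure hP hr2 Metric.isOpen_ball hs₁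
  have hUm : MeasurableSet U := Metric.isOpen_ball.measurableSet
  have hBm : MeasurableSet (Metric.ball z r) := Metric.isOpen_ball.measurableSet
  have hc1 : c ≤ 1 := (hT z (Metric.mem_ball_self hr)).trans prob_le_one
  have hγ : 1 - c * c < 1 :=
    ENNReal.sub_lt_self (by simp) (by simp) (ENNReal.mul_pos hc.ne' hc.ne').ne'
  -- Laws of two independent copies from `z` after time `s₀`: stable under a further step `T`, each
  -- with mass at most `e` outside the product ball.
  let Λ : Set (Measure (E × E)) := {l | ∃ s s', s₀ ≤ s ∧ s₀ ≤ s' ∧ l = (P s z).prod (P s' z)}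
  have hiter := exists_lintegral_iterate_le (P T ∥ₖ P T) (Λ := Λ)
    (W := fun t u ↦ ‖avg P f t u.1 - avg P f t u.2‖ₑ) (T := T) (M := M) (A := U ×ˢ U)
    (B := Metric.ball z r ×ˢ Metric.ball z r) (a := d + d) (N := N) (β := c * c)
    (γ := 1 - c * c) (e := e)
    (by
      rintro _ ⟨s, s', hs, hs', rfl⟩
      exact ⟨s + T, s' + T, hs.trans le_self_add, hs'.trans le_self_add,
        parallelComp_comp_prod_eq hP T s s' z z⟩)
    (fun t ↦ by
      have := continuous_avg hP hf hC t
      exact Continuous.measurable (by fun_prop))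
    (fun t y ↦ by
      rw [Kernel.parallelComp_apply]
      exact enorm_avg_sub_le hP hf hC T T t y.1 y.2)
    (fun t y ↦ by
      rw [Real.enorm_eq_ofReal_abs]
      refine ENNReal.ofReal_le_ofReal ((abs_sub _ _).trans ?_)
      linarith [abs_avg_le (P := P) hC t y.1, abs_avg_le (P := P) hC t y.2])
    (hUm.prod hUm) (hBm.prod hBm)
    (by
      rintro _ ⟨s, s', hs, hs', rfl⟩ t ht
      have h1 : ∀ᵐ y ∂((P s z).prod (P s' z)), y.1 ∈ reachable P z :=
        Measure.quasiMeasurePreserving_fst.ae (measure_compl_reachable z s)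
      have h2 : ∀ᵐ y ∂((P s z).prod (P s' z)), y.2 ∈ reachable P z :=
        Measure.quasiMeasurePreserving_snd.ae (measure_compl_reachable z s')
      filter_upwards [h1, h2] with y hy1 hy2 hy
      rw [hd, ← ENNReal.ofReal_add (by positivity) (by positivity), Real.enorm_eq_ofReal_abs]
      refine ENNReal.ofReal_le_ofReal ?_
      have k1 := hN y.1 hy.1 hy1 t ht
      have k2 := hN y.2 hy.2 hy2 t ht
      rw [abs_le] at k1 k2 ⊢
      constructor <;> linarith [k1.1, k1.2, k2.1, k2.2])
    (add_tsub_cancel_of_le (mul_le_one' hc1 hc1))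
    (fun y hy ↦ by
      rw [prob_compl_eq_one_sub (hUm.prod hUm), Kernel.parallelComp_apply, Measure.prod_prod]
      exact tsub_le_tsub_left (mul_le_mul' (hT _ hy.1) (hT _ hy.2)) 1)
    (by
      rintro _ ⟨s, s', hs, hs', rfl⟩
      refine (prod_compl_prod_le _).trans ?_
      rw [← ENNReal.add_halves e]
      exact add_le_add (hs₀ s hs) (hs₀ s' hs'))
  have hlim : Tendsto (fun k : ℕ ↦ M * (1 - c * c) ^ k) atTop (𝓝 0) := by
    simpa using ENNReal.Tendsto.const_mul (ENNReal.tendsto_pow_atTop_nhds_zero_of_lt_one hγ)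
      (Or.inr hMt)
  obtain ⟨k, hk⟩ := (hlim.eventually_lt_const hd0).exists
  obtain ⟨c', hc', hbound⟩ := hiter k
  refine ⟨s₀ + (k * T + N), fun t ht ↦ ?_⟩
  obtain ⟨s, rfl⟩ := exists_add_of_le ht
  rw [show s₀ + (k * T + N) + s = (s₀ + s) + (k * T + N) by ring]
  have h1 := (enorm_avg_sub_le hP hf hC (s₀ + s) s₀ (k * T + N) z z).trans
    (hbound _ ⟨s₀ + s, s₀, le_self_add, le_rfl, rfl⟩ _ le_rfl N le_rfl)
  have hc'1 : c' ≤ 1 := hc' ▸ le_self_add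
  have h2 : (d + d) * 1 + M * ((1 - c * c) ^ k * 1 + c' * e) ≤ ENNReal.ofReal (ε / 2) := by
    calc (d + d) * 1 + M * ((1 - c * c) ^ k * 1 + c' * e)
        ≤ (d + d) * 1 + M * ((1 - c * c) ^ k * 1 + 1 * e) := by gcongr
      _ = (d + d) + (M * (1 - c * c) ^ k + M * e) := by ring
      _ ≤ (d + d) + (d + d) := by
          gcongr
          rw [he, ENNReal.mul_div_cancel hM0 hMt]
      _ = ENNReal.ofReal (ε / 2) := by
          rw [hd, ← ENNReal.ofReal_add (by positivity) (by positivity),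
            ← ENNReal.ofReal_add (by positivity) (by positivity)]
          congr 1; ring
  rw [measure_univ] at h1
  have h3 := h1.trans h2
  rw [Real.enorm_eq_ofReal_abs, ENNReal.ofReal_le_ofReal_iff (by positivity)] at h3
  rw [Real.dist_eq]
  linarith

/-- If `P_t f` is eventually within `a` of `L` on a ball which is reached with uniformly positive
probability from everywhere, then it is eventually almost within `a` of `L` everywhere. -/
theorem eventually_enorm_avg_sub_le [BorelSpace E] (hP : IsMarkovFellerSemigroup P)
    (hf : Continuous f) (hC : ∀ x, |f x| ≤ C) {L : ℝ} {A : Set E} (hA : MeasurableSet A)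
    {a γ : ℝ≥0∞} (ha : ∀ x ∈ A, ∀ᶠ t in atTop, ‖avg P f t x - L‖ₑ ≤ a)
    (hγ1 : γ ≤ 1) (hγ : ∀ x, ∃ T, P T x Aᶜ ≤ γ) (k : ℕ) {δ : ℝ≥0∞} (hδ : 0 < δ) (hδt : δ ≠ ∞)
    (x : E) : ∀ᶠ t in atTop,
      ‖avg P f t x - L‖ₑ ≤ a + γ ^ k * ENNReal.ofReal (C + |L|) + δ := by
  set M := ENNReal.ofReal (C + |L|) with hM
  have hWM : ∀ t y, ‖avg P f t y - L‖ₑ ≤ M := fun t y ↦ by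
    rw [Real.enorm_eq_ofReal_abs]
    refine ENNReal.ofReal_le_ofReal ((abs_sub _ _).trans ?_)
    linarith [abs_avg_le (P := P) hC t y]
  induction k generalizing δ x with
  | zero =>
    refine Eventually.of_forall fun t ↦ (hWM t x).trans ?_
    rw [pow_zero, one_mul, add_right_comm]
    exact le_add_self
  | succ k ih =>
    obtain ⟨T, hT⟩ := hγ x
    set c := γ ^ k * M + δ / 2 with hc
    have hδ2 : 0 < δ / 2 := ENNReal.half_pos hδ.ne'
    let W : ℝ≥0 → E → ℝ≥0∞ := fun t y ↦ ‖avg P f t y - L‖ₑ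
    have hWm : ∀ t, Measurable (W t) := fun t ↦ by
      have := continuous_avg hP hf hC t
      exact Continuous.measurable (by fun_prop)
    -- The eventual pointwise bound for `W`: `a` on `A`, and the induction bound off `A`. The excess
    -- `W t - h`, truncated at `0`, vanishes eventually at each point, so its integral tends to `0`
    -- by domination.
    let h : E → ℝ≥0∞ := fun y ↦ a + Aᶜ.indicator (fun _ ↦ c) y
    have hhm : Measurable h := measurable_const.add (measurable_const.indicator hA.compl)
    have hev : ∀ y, ∀ᶠ t in atTop, W t y ≤ h y := by
      intro y
      by_cases hy : y ∈ A
      · filter_upwards [ha y hy] with t ht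
        exact ht.trans le_self_add
      · filter_upwards [ih hδ2 (by finiteness) y] with t ht
        simpa [h, hy, hc, add_assoc] using ht
    have hlim : Tendsto (fun t ↦ ∫⁻ y, (W t y - h y) ∂(P T x)) atTop (𝓝 0) := by
      have := tendsto_lintegral_filter_of_dominated_convergence (μ := P T x) (l := atTop)
        (F := fun t y ↦ W t y - h y) (f := fun _ ↦ 0) (fun _ ↦ M)
        (Eventually.of_forall fun t ↦ (hWm t).sub hhm)
        (Eventually.of_forall fun t ↦ ae_of_all _ fun y ↦ tsub_le_self.trans (hWM t y))
        (by simp [hM]) (ae_of_all _ fun y ↦ tendsto_const_nhds.congr'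
          ((hev y).mono fun t ht ↦ (tsub_eq_zero_of_le ht).symm))
      simpa using this
    have hh : ∫⁻ y, h y ∂(P T x) ≤ a + c * γ := by
      rw [lintegral_add_left measurable_const, lintegral_indicator hA.compl]
      simp only [lintegral_const, measure_univ, mul_one, Measure.restrict_apply_univ]
      gcongr
    have hshift : Tendsto (fun t : ℝ≥0 ↦ t - T) atTop atTop :=
      tendsto_atTop.2 fun b ↦ (eventually_ge_atTop (b + T)).mono fun t ht ↦
        le_tsub_of_add_le_right ht
    filter_upwards [hshift.eventually (hlim.eventually_lt_const hδ2), eventually_ge_atTop T]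
      with t ht htT
    have hadd : avg P f t x - L = ∫ y, (avg P f (t - T) y - L) ∂(P T x) := by
      rw [integral_sub (integrable_of_abs_le (continuous_avg hP hf hC _).measurable
        (abs_avg_le hC _) _) (integrable_const _), ← avg_add hP hf hC, add_tsub_cancel_of_le htT]
      simp
    rw [hadd]
    calc ‖∫ y, (avg P f (t - T) y - L) ∂(P T x)‖ₑ ≤ ∫⁻ y, W (t - T) y ∂(P T x) :=
          enorm_integral_le_lintegral_enorm _
      _ ≤ ∫⁻ y, ((W (t - T) y - h y) + h y) ∂(P T x) := lintegral_mono fun y ↦ le_tsub_add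
      _ = ∫⁻ y, (W (t - T) y - h y) ∂(P T x) + ∫⁻ y, h y ∂(P T x) := lintegral_add_right _ hhm
      _ ≤ δ / 2 + (a + c * γ) := add_le_add ht.le hh
      _ = a + γ ^ (k + 1) * M + (δ / 2 * γ + δ / 2) := by rw [hc, pow_succ]; ring
      _ ≤ a + γ ^ (k + 1) * M + (δ / 2 * 1 + δ / 2) := by gcongr
      _ = a + γ ^ (k + 1) * M + δ := by rw [mul_one, ENNReal.add_halves]

/-- Convergence of `P_t f` at `z` propagates to all starting points. -/
theorem tendsto_avg_of_tendsto_self [BorelSpace E] (hP : IsMarkovFellerSemigroup P)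
    (hf : Continuous f) (hC : ∀ x, |f x| ≤ C)
    (hec : ∀ η : ℝ, 0 < η → ∃ ε > 0, ∀ x ∈ Metric.ball z ε, ∀ᶠ t in atTop,
      |avg P f t x - avg P f t z| ≤ η)
    (hball : ∀ η : ℝ≥0∞, 0 < η → ∃ r, 0 < r ∧
      (∀ x, ∀ᶠ t in atTop, P t x (Metric.ball z r)ᶜ ≤ η) ∧
      ∀ ε : ℝ, 0 < ε → ∃ T : ℝ≥0, 0 < T ∧
        0 < ⨅ x ∈ Metric.ball z r, P T x (Metric.ball z ε))
    {L : ℝ} (hL : Tendsto (fun t ↦ avg P f t z) atTop (𝓝 L)) (x : E) :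
    Tendsto (fun t ↦ avg P f t x) atTop (𝓝 L) := by
  refine Metric.tendsto_nhds.2 fun η hη ↦ ?_
  obtain ⟨ε, hε, hε'⟩ := hec (η / 8) (by positivity)
  set d := ENNReal.ofReal (η / 4) with hd
  have hd0 : 0 < d := ENNReal.ofReal_pos.2 (by positivity)
  have ha : ∀ y ∈ Metric.ball z ε, ∀ᶠ t in atTop, ‖avg P f t y - L‖ₑ ≤ d := by
    intro y hy
    filter_upwards [hε' y hy, Metric.tendsto_nhds.1 hL (η / 8) (by positivity)] with t h1 h2
    rw [Real.enorm_eq_ofReal_abs]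
    refine ENNReal.ofReal_le_ofReal ((abs_sub_le _ (avg P f t z) _).trans ?_)
    rw [Real.dist_eq] at h2
    linarith
  obtain ⟨r, hr, hr1, hr2⟩ := hball (1 / 2) (by simp)
  have hmA : MeasurableSet (Metric.ball z ε) := Metric.isOpen_ball.measurableSet
  obtain ⟨T, hT0, hT⟩ := hr2 ε hε
  set c := ⨅ x ∈ Metric.ball z r, P T x (Metric.ball z ε)
  -- At a late time the process is in the `r`-ball with probability at least `1 / 2`, and from there
  -- it reaches the `ε`-ball with probability at least `c`.
  have hγ : ∀ y, ∃ s, P s y (Metric.ball z ε)ᶜ ≤ 1 - c * (1 / 2) := by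
    intro y
    obtain ⟨s, hs⟩ := (hr1 y).exists
    refine ⟨s + T, ?_⟩
    rw [prob_compl_eq_one_sub hmA]
    refine tsub_le_tsub_left (mul_le_measure_add hP hmA Metric.isOpen_ball.measurableSet
      (fun u hu ↦ iInf₂_le u hu) ?_) 1
    rw [prob_compl_eq_one_sub Metric.isOpen_ball.measurableSet, tsub_le_iff_right] at hs
    have h2 : (1 / 2 : ℝ≥0∞) + 1 / 2 ≤ 1 / 2 + P s y (Metric.ball z r) := by
      rwa [ENNReal.add_halves]
    exact (ENNReal.add_le_add_iff_left (by simp)).1 h2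
  have hγ1 : 1 - c * (1 / 2) < 1 :=
    ENNReal.sub_lt_self (by simp) (by simp) (ENNReal.mul_pos hT.ne' (by simp)).ne'
  have hlim : Tendsto (fun k : ℕ ↦ (1 - c * (1 / 2)) ^ k * ENNReal.ofReal (C + |L|)) atTop
      (𝓝 0) := by
    simpa using ENNReal.Tendsto.mul_const (ENNReal.tendsto_pow_atTop_nhds_zero_of_lt_one hγ1)
      (Or.inr (ENNReal.ofReal_ne_top (r := C + |L|)))
  obtain ⟨k, hk⟩ := (hlim.eventually_lt_const hd0).exists
  filter_upwards [eventually_enorm_avg_sub_le hP hf hC hmA ha hγ1.le hγ k hd0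
    ENNReal.ofReal_ne_top x] with t ht
  have h3 : ‖avg P f t x - L‖ₑ ≤ ENNReal.ofReal (η / 4 + η / 4 + η / 4) := by
    rw [ENNReal.ofReal_add (by positivity) (by positivity),
      ENNReal.ofReal_add (by positivity) (by positivity)]
    exact ht.trans (by gcongr)
  rw [Real.enorm_eq_ofReal_abs, ENNReal.ofReal_le_ofReal_iff (by positivity)] at h3
  rw [Real.dist_eq]
  linarith

end Convergence

/-! ### Asymptotic stability -/

theorem corollary2p1 {E Ω : Type*} [MetricSpace E] [CompleteSpace E] [SecondCountableTopology E]
    [MeasurableSpace E] [BorelSpace E] [MeasurableSpace Ω]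
    (P : ℝ≥0 → Kernel E E) [∀ t, IsMarkovKernel (P t)] (hP : IsMarkovFellerSemigroup P)
    (Pr : Measure Ω) [IsProbabilityMeasure Pr] (X : E → ℝ≥0 → Ω → E)
    (hX : IsMarkovProcessFor P Pr X)
    (z : E) (hz : EventuallyContinuousAt P z)
    (hirr : ∃ r₀ : ℝ, 0 < r₀ ∧ ∀ ε : ℝ, 0 < ε → ∀ r : ℝ, r₀ < r → ∃ T : ℝ≥0, 0 < T ∧
      0 < ⨅ x ∈ Metric.ball z r, P T x (Metric.ball z ε))
    (hmom : ∃ (p b : ℝ) (κ : ℝ≥0∞), 0 < p ∧ 0 < b ∧ 0 < κ ∧ ∀ x : E, ∃ ρ : ℝ≥0 → ℝ,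
      (∀ t, 0 < t → 0 < ρ t) ∧ AntitoneOn ρ (Set.Ioi 0) ∧ Tendsto ρ atTop (𝓝 0) ∧
      ∀ t, 0 < t → ∫⁻ ω, ENNReal.ofReal (dist (X x t ω) z ^ p) ∂Pr ≤
        ENNReal.ofReal (ρ t) +
          (Metric.eball z κ).indicator (fun _ ↦ ENNReal.ofReal b) x) :
    AsymptoticallyStable P := by
  obtain ⟨r₀, hr₀, hirr⟩ := hirr
  obtain ⟨p, b, κ, hp, hb, -, hmom⟩ := hmom
  have hmom' : ∀ x, ∃ ρ : ℝ≥0 → ℝ, Tendsto ρ atTop (𝓝 0) ∧ ∀ t, 0 < t →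
      ∫⁻ y, ENNReal.ofReal (dist y z ^ p) ∂(P t x) ≤ ENNReal.ofReal (ρ t) + ENNReal.ofReal b := by
    intro x
    obtain ⟨ρ, -, -, hρ, h⟩ := hmom x
    refine ⟨ρ, hρ, fun t ht ↦ ?_⟩
    rw [← hX.map_eq x t, lintegral_map (Measurable.ennreal_ofReal (by fun_prop))
      (hX.measurable x t)]
    refine (h t ht).trans ?_
    gcongr
    exact indicator_le_self' (fun _ _ ↦ zero_le) x
  have hball : ∀ η : ℝ≥0∞, 0 < η → ∃ r, 0 < r ∧
      (∀ x, ∀ᶠ t in atTop, P t x (Metric.ball z r)ᶜ ≤ η) ∧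
      ∀ ε : ℝ, 0 < ε → ∃ T : ℝ≥0, 0 < T ∧
        0 < ⨅ x ∈ Metric.ball z r, P T x (Metric.ball z ε) := by
    intro η hη
    obtain ⟨r, hr, h⟩ := exists_eventually_measure_compl_ball_le hp hb hmom' r₀ hη
    exact ⟨r, hr₀.trans hr, h, fun ε hε ↦ hirr ε hε r hr⟩
  have hconv : ∀ f : E → ℝ, (∃ K, LipschitzWith K f) → (∃ C, ∀ x, |f x| ≤ C) →
      ∃ L, ∀ x, Tendsto (fun t ↦ avg P f t x) atTop (𝓝 L) := by
    rintro f hf ⟨C, hC⟩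
    have hfc : Continuous f := hf.choose_spec.continuous
    have hec := fun η (hη : (0 : ℝ) < η) ↦ hz.exists_forall_ball hf hC hη
    obtain ⟨L, hL⟩ := exists_tendsto_avg_self hP hfc hC hec hball
    exact ⟨L, tendsto_avg_of_tendsto_self hP hfc hC hec hball hL⟩
  obtain ⟨μ, hμ⟩ := exists_tendsto_integral_lipschitz
    (fun n : ℕ ↦ ⟨P n z, inferInstance⟩) fun f hf hfb ↦ by
      obtain ⟨L, hL⟩ := hconv f hf hfb
      exact ⟨L, (hL z).comp tendsto_natCast_atTop_atTop⟩
  refine ⟨μ, fun ν ↦ tendsto_iff_forall_lipschitz_integral_tendsto.2 ?_⟩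
  rintro f ⟨D, hD⟩ hf
  -- The test functions come with a bound `D` on their oscillation, which is turned into a bound on
  -- `|f|`.
  have hC : ∀ x, |f x| ≤ |f z| + D := fun x ↦ by
    have := hD x z
    rw [Real.dist_eq] at this
    linarith [abs_sub_abs_le_abs_sub (f x) (f z)]
  have hfc : Continuous f := hf.choose_spec.continuous
  obtain ⟨L, hL⟩ := hconv f hf ⟨_, hC⟩
  have hLμ : ∫ x, f x ∂(μ : Measure E) = L :=
    tendsto_nhds_unique (hμ f hf ⟨_, hC⟩) ((hL z).comp tendsto_natCast_atTop_atTop)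
  have hbind : ∀ t, ∫ x, f x ∂(dualSemigroup P t ν : Measure E) =
      ∫ x, avg P f t x ∂(ν : Measure E) := by
    intro t
    have h : (dualSemigroup P t ν : Measure E) = (P t ∘ₖ Kernel.const Unit (ν : Measure E)) () :=
      Measure.comp_eq_comp_const_apply
    have hi := integrable_of_abs_le hfc.measurable hC
      ((P t ∘ₖ Kernel.const Unit (ν : Measure E)) ())
    rw [h, Kernel.integral_comp hi, Kernel.const_apply]
    rfl
  simp only [hbind, hLμ]
  have := tendsto_integral_filter_of_dominated_convergence (μ := (ν : Measure E)) (l := atTop)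
    (F := avg P f) (f := fun _ ↦ L) (fun _ ↦ |f z| + D)
    (Eventually.of_forall fun t ↦ (continuous_avg hP hfc hC t).aestronglyMeasurable)
    (Eventually.of_forall fun t ↦ ae_of_all _ fun x ↦ abs_avg_le hC t x)
    (integrable_const _) (ae_of_all _ hL)
  simpa using this
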